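/- Let $N_1,N_2\in\mathbb{N}$, $N=N_1N_2$, and let $\{|i\rangle\}_{i=1}^{N_1}$ and $\{|j\rangle\}_{j=1}^{N_2}$ be orthonormal bases of $\mathbb{C}^{N_1}$ and $\mathbb{C}^{N_2}$. Let $$\rho=\sum_{i=1}^{N_1}\sum_{j=1}^{N_2}p_{ij}\,|i\rangle\langle i|\otimes|j\rangle\langle j|,\qquad p_{ij}\ge 0,\quad \sum_{i,j}p_{ij}=1,$$ be a classical-classical (CC) state on $\mathbb{C}^{N_1}\otimes\mathbb{C}^{N_2}$. Let $K=SU(N_1)\times SU(N_2)$ act by $\sigma\mapsto (U\otimes V)\,\sigma\,(U\otimes V)^{-1}$, with Lie algebra $\mathfrak{k}=\{X_1\otimes I+I\otimes X_2 : X_1\in\mathfrak{su}(N_1),\,X_2\in\mathfrak{su}(N_2)\}$, and let $K.\rho$ be the orbit of $\rho$, whose tangent space at $\sigma$ is $T_\sigma(K.\rho)=\{[X,\sigma]:X\in\mathfrak{k}\}$. Let $\omega$ be the Kirillov–Kostant–Souriau (KKS) form on the $SU(N)$-orbit of $\rho$: for $X,Y\in\mathfrak{su}(N)$, $$\omega_\sigma([X,\sigma],[Y,\sigma])=(i\sigma\,|\,[Y,X]),\qquad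 (A\,|\,B)=-\mathrm{tr}(AB).$$ Then $K.\rho$ is symplectic, that is, the restriction $\omega|_{K.\rho}$ is a smooth closed 2-form on $K.\rho$ that is non-degenerate at every point, if and only if both of the following conditions hold: 1. for all $i\neq j$ in $\{1,\dots,N_1\}$: if $\sum_{l=1}^{N_2}p_{il}=\sum_{l=1}^{N_2}p_{jl}$, then $p_{il}=p_{jl}$ for all $l\in\{1,\dots,N_2\}$; 2. for all $i\neq j$ in $\{1,\dots,N_2\}$: if $\sum_{l=1}^{N_1}p_{li}=\sum_{l=1}^{N_1}p_{lj}$, then $p_{li}=p_{lj}$ for all $l\in\{1,\dots,N_1\}$. -/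

import Mathlib

open scoped Kronecker Matrix ContDiff Matrix.Norms.Frobenius

noncomputable section

namespace LocalOrbits

variable {n m : Type*} [Fintype n] [DecidableEq n] [Fintype m] [DecidableEq m]

/-! ### Lie algebras and tangent spaces of adjoint orbits -/

/-- The Lie algebra `su(n)`: traceless anti-Hermitian complex matrices, as a real vector space. -/
def su (n : Type*) [Fintype n] [DecidableEq n] : Submodule ℝ (Matrix n n ℂ) where
  carrier := {X | Xᴴ = -X ∧ X.trace = 0}
  zero_mem' := by simp
  add_mem' := by
    rintro X Y ⟨hX, hX'⟩ ⟨hY, hY'⟩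
    refine ⟨?_, by simp [hX', hY']⟩
    rw [Matrix.conjTranspose_add, hX, hY, neg_add]
  smul_mem' := by
    rintro c X ⟨hX, hX'⟩
    refine ⟨?_, by simp [hX']⟩
    rw [Matrix.conjTranspose_smul, hX]
    simp

/-- The Lie algebra of `SU(n) × SU(m)`, embedded in the operators on `ℂⁿ ⊗ ℂᵐ` by
`(X₁, X₂) ↦ X₁ ⊗ I + I ⊗ X₂`. -/
def suLocal (n m : Type*) [Fintype n] [DecidableEq n] [Fintype m] [DecidableEq m] :
    Submodule ℝ (Matrix (n × m) (n × m) ℂ) where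
  carrier := {X | ∃ X₁ ∈ su n, ∃ X₂ ∈ su m,
    X = X₁ ⊗ₖ (1 : Matrix m m ℂ) + (1 : Matrix n n ℂ) ⊗ₖ X₂}
  zero_mem' := ⟨0, zero_mem _, 0, zero_mem _, by simp⟩
  add_mem' := by
    rintro _ _ ⟨X₁, h₁, X₂, h₂, rfl⟩ ⟨Y₁, k₁, Y₂, k₂, rfl⟩
    refine ⟨X₁ + Y₁, add_mem h₁ k₁, X₂ + Y₂, add_mem h₂ k₂, ?_⟩
    rw [Matrix.add_kronecker, Matrix.kronecker_add]
    abel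
  smul_mem' := by
    rintro c _ ⟨X₁, h₁, X₂, h₂, rfl⟩
    refine ⟨c • X₁, Submodule.smul_mem _ c h₁, c • X₂, Submodule.smul_mem _ c h₂, ?_⟩
    rw [Matrix.smul_kronecker, Matrix.kronecker_smul, smul_add]

theorem suLocal_le_su : suLocal n m ≤ su (n × m) := by
  rintro _ ⟨X₁, ⟨h₁, t₁⟩, X₂, ⟨h₂, t₂⟩, rfl⟩
  refine ⟨?_, by simp [Matrix.trace_kronecker, t₁, t₂]⟩
  rw [Matrix.conjTranspose_add, Matrix.conjTranspose_kronecker, Matrix.conjTranspose_kronecker,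
    h₁, h₂, Matrix.conjTranspose_one, Matrix.conjTranspose_one]
  ext ⟨i, j⟩ ⟨k, l⟩
  simp [Matrix.kroneckerMap_apply]
  ring

/-- The fundamental vector field at `σ` of the adjoint action, as a linear function of the Lie
algebra element: `X ↦ X̃_σ = [X, σ]`. -/
def fundamental (σ : Matrix n n ℂ) : Matrix n n ℂ →ₗ[ℝ] Matrix n n ℂ where
  toFun X := X * σ - σ * X
  map_add' X Y := by rw [add_mul, mul_add]; abel
  map_smul' c X := by simp [smul_sub]

/-- `X̃_σ` is the velocity at `t = 0` of `t ↦ exp(tX) σ exp(-tX)`. -/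
theorem hasDerivAt_fundamental (σ X : Matrix n n ℂ) :
    HasDerivAt (fun t : ℝ => NormedSpace.exp (t • X) * σ * NormedSpace.exp (t • (-X)))
      (fundamental σ X) 0 := by
  have h1 := hasDerivAt_exp_smul_const (𝕂 := ℝ) X (0 : ℝ)
  have h2 := hasDerivAt_exp_smul_const (𝕂 := ℝ) (-X) (0 : ℝ)
  have h := (h1.mul_const σ).mul h2
  have e : NormedSpace.exp ((0 : ℝ) • X) * X * σ * NormedSpace.exp ((0 : ℝ) • (-X)) +
      NormedSpace.exp ((0 : ℝ) • X) * σ * (NormedSpace.exp ((0 : ℝ) • (-X)) * -X) =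
      fundamental σ X := by
    simp [fundamental, sub_eq_add_neg]
  rw [← e]
  exact h

/-- The tangent space at `σ` of the adjoint orbit through `σ` of the group with Lie algebra `𝔥`:
the span of the fundamental vector fields, `{[X, σ] : X ∈ 𝔥}`. -/
def orbitTangent (𝔥 : Submodule ℝ (Matrix n n ℂ)) (σ : Matrix n n ℂ) :
    Submodule ℝ (Matrix n n ℂ) :=
  𝔥.map (fundamental σ)

theorem orbitTangent_mono {𝔥 𝔤 : Submodule ℝ (Matrix n n ℂ)} (h : 𝔥 ≤ 𝔤) (σ : Matrix n n ℂ) :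
    orbitTangent 𝔥 σ ≤ orbitTangent 𝔤 σ :=
  Submodule.map_mono h

/-! ### The Kirillov-Kostant-Souriau form -/

/-- The inner product `(X | Y) = -tr(XY)`, a real number when `X` and `Y` are anti-Hermitian. -/
def traceInner (X Y : Matrix n n ℂ) : ℝ := -(X * Y).trace.re

/-- On anti-Hermitian matrices, taking the real part in `traceInner` discards nothing. -/
theorem traceInner_eq {X Y : Matrix n n ℂ} (hX : Xᴴ = -X) (hY : Yᴴ = -Y) :
    (traceInner X Y : ℂ) = -(X * Y).trace := by
  have h : star (X * Y).trace = (X * Y).trace := by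
    rw [← Matrix.trace_conjTranspose, Matrix.conjTranspose_mul, hX, hY, neg_mul_neg,
      Matrix.trace_mul_comm]
  have h' : ((X * Y).trace.re : ℂ) = (X * Y).trace := Complex.conj_eq_iff_re.1 h
  rw [traceInner, Complex.ofReal_neg, h']

/-- `(iσ | [Y, X])`, the value of the Kirillov-Kostant-Souriau form at `σ` on `X̃_σ` and `Ỹ_σ`. -/
def kksOnAlgebra (σ X Y : Matrix n n ℂ) : ℝ :=
  traceInner (Complex.I • σ) (Y * X - X * Y)

theorem kksOnAlgebra_eq_left (σ X Y : Matrix n n ℂ) :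
    kksOnAlgebra σ X Y = traceInner Y (Complex.I • fundamental σ X) := by
  have h1 : (σ * (Y * X)).trace = (Y * (X * σ)).trace := by
    rw [Matrix.trace_mul_comm, Matrix.mul_assoc]
  have h2 : (σ * (X * Y)).trace = (Y * (σ * X)).trace := by
    rw [← Matrix.mul_assoc, Matrix.trace_mul_comm]
  simp only [kksOnAlgebra, traceInner, fundamental, LinearMap.coe_mk, AddHom.coe_mk,
    Matrix.smul_mul, Matrix.mul_smul, Matrix.mul_sub, Matrix.trace_smul, Matrix.trace_sub, h1, h2,
    smul_sub]

theorem kksOnAlgebra_swap (σ X Y : Matrix n n ℂ) :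
    kksOnAlgebra σ X Y = -kksOnAlgebra σ Y X := by
  simp only [kksOnAlgebra, traceInner]
  rw [← neg_sub (X * Y) (Y * X), mul_neg, Matrix.trace_neg, Complex.neg_re]

/-- `(iσ | [Y, X])` depends only on the tangent vectors `X̃_σ` and `Ỹ_σ`. -/
theorem kksOnAlgebra_congr {σ X X' Y Y' : Matrix n n ℂ} (hX : fundamental σ X = fundamental σ X')
    (hY : fundamental σ Y = fundamental σ Y') : kksOnAlgebra σ X Y = kksOnAlgebra σ X' Y' := by
  rw [kksOnAlgebra_eq_left, hX, ← kksOnAlgebra_eq_left, kksOnAlgebra_swap, kksOnAlgebra_eq_left,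
    hY, ← kksOnAlgebra_eq_left, ← kksOnAlgebra_swap]

/-- A Lie algebra element `X ∈ 𝔥` with `X̃_σ = u`. -/
def lift {𝔥 : Submodule ℝ (Matrix n n ℂ)} {σ : Matrix n n ℂ} (u : orbitTangent 𝔥 σ) :
    Matrix n n ℂ :=
  Classical.choose u.2

theorem lift_mem {𝔥 : Submodule ℝ (Matrix n n ℂ)} {σ : Matrix n n ℂ} (u : orbitTangent 𝔥 σ) :
    lift u ∈ 𝔥 :=
  (Classical.choose_spec u.2).1

theorem fundamental_lift {𝔥 : Submodule ℝ (Matrix n n ℂ)} {σ : Matrix n n ℂ}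
    (u : orbitTangent 𝔥 σ) : fundamental σ (lift u) = u :=
  (Classical.choose_spec u.2).2

/-- The Kirillov-Kostant-Souriau form at `σ` on the tangent space of the full orbit
`{g σ g⁻¹ : g ∈ SU(n)}`, given by `ω_σ(X̃_σ, Ỹ_σ) = (iσ | [Y, X])`. -/
def kks (σ : Matrix n n ℂ) : LinearMap.BilinForm ℝ (orbitTangent (su n) σ) :=
  LinearMap.mk₂ ℝ (fun u v => kksOnAlgebra σ (lift u) (lift v))
    (fun u u' v => by
      rw [kksOnAlgebra_congr (X' := lift u + lift u') (Y' := lift v)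
        (by simp [fundamental_lift]) rfl]
      simp only [kksOnAlgebra_eq_left, map_add, smul_add, traceInner, mul_add, Matrix.trace_add,
        Complex.add_re, neg_add])
    (fun c u v => by
      rw [kksOnAlgebra_congr (X' := c • lift u) (Y' := lift v)
        (by simp [fundamental_lift]) rfl]
      simp only [kksOnAlgebra_eq_left, map_smul, traceInner, smul_comm Complex.I c,
        Matrix.mul_smul, Matrix.trace_smul, Complex.smul_re, smul_neg])
    (fun u v v' => by
      rw [kksOnAlgebra_congr (X' := lift u) (Y' := lift v + lift v')
        rfl (by simp [fundamental_lift])]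
      simp only [kksOnAlgebra_eq_left, traceInner, add_mul, Matrix.trace_add,
        Complex.add_re, neg_add])
    (fun c u v => by
      rw [kksOnAlgebra_congr (X' := lift u) (Y' := c • lift v)
        rfl (by simp [fundamental_lift])]
      simp only [kksOnAlgebra_eq_left, traceInner,
        Matrix.smul_mul, Matrix.trace_smul, Complex.smul_re, smul_neg])

/-- The defining property of the Kirillov-Kostant-Souriau form. -/
theorem kks_apply (σ : Matrix n n ℂ) {X Y : Matrix n n ℂ} (hX : X ∈ su n) (hY : Y ∈ su n) :
    kks σ ⟨fundamental σ X, X, hX, rfl⟩ ⟨fundamental σ Y, Y, hY, rfl⟩ =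
      traceInner (Complex.I • σ) (Y * X - X * Y) :=
  kksOnAlgebra_congr (fundamental_lift _) (fundamental_lift _)

/-- The restriction of the Kirillov-Kostant-Souriau form to the tangent space at `σ` of the
`SU(n) × SU(m)`-orbit through `σ`. -/
def kksLocal (σ : Matrix (n × m) (n × m) ℂ) :
    LinearMap.BilinForm ℝ (orbitTangent (suLocal n m) σ) :=
  (kks σ).comp (Submodule.inclusion (orbitTangent_mono suLocal_le_su σ))
    (Submodule.inclusion (orbitTangent_mono suLocal_le_su σ))

/-! ### Symplectic forms on embedded submanifolds -/

/-- A family `form` of bilinear forms on the tangent spaces `T σ` of an embedded submanifold `M` of a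
normed space is a symplectic form if it is a smooth closed 2-form and is non-degenerate at every
point of `M`. Smoothness and closedness are expressed by smooth ambient 2-forms `Ω` that locally
restrict to `form`: the exterior derivative of `form` is the restriction of that of `Ω`. -/
structure IsSymplecticForm {V : Type*} [NormedAddCommGroup V] [NormedSpace ℝ V] (M : Set V)
    (T : V → Submodule ℝ V) (form : ∀ σ, LinearMap.BilinForm ℝ (T σ)) : Prop where
  smooth_closed : ∀ σ ∈ M, ∃ U : Set V, IsOpen U ∧ σ ∈ U ∧
    ∃ Ω : V → V [⋀^Fin 2]→L[ℝ] ℝ, ContDiffOn ℝ ∞ Ω U ∧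
      ∀ τ ∈ U ∩ M,
        (∀ u v : T τ, form τ u v = Ω τ ![(u : V), (v : V)]) ∧
        (∀ u v w : T τ, extDeriv Ω τ ![(u : V), (v : V), (w : V)] = 0)
  nondegenerate : ∀ σ ∈ M, (form σ).Nondegenerate

/-! ### Local orbits and classical-classical states -/

/-- The orbit of `ρ` under the adjoint action of `SU(n) × SU(m)`, embedded as `U ⊗ V`. -/
def localOrbit (ρ : Matrix (n × m) (n × m) ℂ) : Set (Matrix (n × m) (n × m) ℂ) :=
  {σ | ∃ U ∈ Matrix.specialUnitaryGroup n ℂ, ∃ V ∈ Matrix.specialUnitaryGroup m ℂ,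
    σ = (U ⊗ₖ V) * ρ * (U ⊗ₖ V)ᴴ}

/-- The `SU(n) × SU(m)`-orbit through `ρ` is symplectic with respect to the restricted
Kirillov-Kostant-Souriau form. -/
def LocalOrbitIsSymplectic (ρ : Matrix (n × m) (n × m) ℂ) : Prop :=
  IsSymplecticForm (localOrbit ρ) (orbitTangent (suLocal n m)) kksLocal

/-- The operator `|x⟩⟨x|`. -/
def ketBra (x : EuclideanSpace ℂ n) : Matrix n n ℂ :=
  Matrix.of fun a b => x a * star (x b)

/-- The operator `∑ i j, p i j |e i⟩⟨e i| ⊗ |f j⟩⟨f j|`. -/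
def ccOperator (e : OrthonormalBasis n ℂ (EuclideanSpace ℂ n))
    (f : OrthonormalBasis m ℂ (EuclideanSpace ℂ m)) (p : n → m → ℝ) :
    Matrix (n × m) (n × m) ℂ :=
  ∑ i, ∑ j, (p i j : ℂ) • (ketBra (e i) ⊗ₖ ketBra (f j))

end LocalOrbits

end

/-!
# Symplectic local orbits of classical-classical states

Write `F_σ X = [X, σ]`. The tangent vectors of an orbit at `σ` are the values of `F_σ`, and the
Kirillov-Kostant-Souriau form is `ω_σ(F_σ X, F_σ Y) = (iσ | [Y, X])`.

*Smoothness and closedness hold on every orbit.* The state is unitarily equivalent to a real diagonal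
matrix, on which `F` acts entrywise by the differences of the eigenvalues. Interpolating `t ↦ t⁻¹` at
these differences gives a real polynomial `q` with `F q(F) F = F`
(`exists_isPseudoInverse_realDiagonal`), and by equivariance the same `q` works at every conjugate of
the state (`IsPseudoInverse.conj`). Replacing the choice of a preimage of a tangent vector `v` by
`q(F_σ) v` then defines a `2`-form on the whole matrix space that is polynomial in `σ` and restricts
to `ω` (`ambientForm_commutator`). Evaluating its exterior derivative on the linear vector fields
`σ ↦ [X, σ]` reduces closedness to the Jacobi identity (`extDeriv_ambientForm_commutator`). The trace
enters only through `φ(ab) = φ(ba)`, so this part is carried out for a tracial functional on a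
finite-dimensional normed algebra.

*Non-degeneracy is decided at the diagonal state.* By equivariance under local unitaries it is the
same condition at every point of the orbit, and it may be tested in the product basis
(`kksLocal_conj_nondegenerate_iff`). There, pairing with `Y₁ ⊗ 1 + 1 ⊗ Y₂` only sees the marginals of
`p` (`kksOnAlgebra_realDiagonal_local`). Hence `X₁ ⊗ 1 + 1 ⊗ X₂` lies in the radical iff `X₁` and `X₂`
commute with the respective marginals, and non-degeneracy asks that it then commute with the state.
For the generators `E_ij - E_ji` this is the stated condition on the rows and columns of `p`, and the
general case follows entry by entry (`kksLocal_realDiagonal_nondegenerate_iff`).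
-/

noncomputable section

namespace LocalOrbits

/-! ### A polynomial pseudo-inverse of the commutator map -/

theorem aeval_mul_eq_mul_aeval {R : Type*} [Ring R] [Algebra ℝ R] {f f' c : R}
    (h : f * c = c * f') (q : Polynomial ℝ) :
    Polynomial.aeval f q * c = c * Polynomial.aeval f' q := by
  induction q using Polynomial.induction_on' with
  | add a b ha hb => simp only [map_add, add_mul, mul_add, ha, hb]
  | monomial k a =>
    have hk : f ^ k * c = c * f' ^ k := by
      have hs : SemiconjBy c f' f := h.symm
      exact (hs.pow_right k).symm
    simp only [Polynomial.aeval_monomial, Algebra.algebraMap_eq_smul_one, smul_mul_assoc, one_mul,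
      mul_smul_comm, hk]

section NormedAlgebra

variable {A : Type*} [NormedRing A] [NormedAlgebra ℝ A]

/-- The commutator `X ↦ [X, σ]` in a normed algebra, as a bounded operator depending linearly
on `σ`. -/
def commutator : A →L[ℝ] A →L[ℝ] A :=
  (ContinuousLinearMap.mul ℝ A).flip - ContinuousLinearMap.mul ℝ A

theorem commutator_apply (σ X : A) : commutator σ X = X * σ - σ * X := rfl

/-- `q([·, σ])` is a generalized inverse of the commutator map `[·, σ]`. -/
def IsPseudoInverse (q : Polynomial ℝ) (σ : A) : Prop :=
  ∀ X, commutator σ (Polynomial.aeval (commutator σ) q (commutator σ X)) = commutator σ X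

theorem commutator_conj {g h : A} (hgh : h * g = 1) (σ X : A) :
    commutator (g * σ * h) (g * X * h) = g * commutator σ X * h := by
  have e (a b : A) : g * a * h * (g * b * h) = g * (a * b) * h := by
    calc g * a * h * (g * b * h) = g * a * (h * g) * b * h := by noncomm_ring
      _ = _ := by rw [hgh]; noncomm_ring
  simp only [commutator_apply, e, mul_sub, sub_mul]

/-- One polynomial is a pseudo-inverse along a whole conjugacy class. -/
theorem IsPseudoInverse.conj {q : Polynomial ℝ} {σ : A} (hq : IsPseudoInverse q σ)
    {g h : A} (hgh : g * h = 1) (hhg : h * g = 1) : IsPseudoInverse q (g * σ * h) := by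
  let c : A →L[ℝ] A := (ContinuousLinearMap.mul ℝ A).flip h ∘L ContinuousLinearMap.mul ℝ A g
  have hc (X : A) : c X = g * X * h := rfl
  have hint : commutator (g * σ * h) * c = c * commutator σ := by
    refine ContinuousLinearMap.ext fun X => ?_
    exact commutator_conj hhg σ X
  have hF (X : A) : commutator (g * σ * h) (c X) = c (commutator σ X) :=
    DFunLike.congr_fun hint X
  have hQ (X : A) : Polynomial.aeval (commutator (g * σ * h)) q (c X) =
      c (Polynomial.aeval (commutator σ) q X) :=
    DFunLike.congr_fun (aeval_mul_eq_mul_aeval hint q) X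
  intro X
  obtain ⟨Z, rfl⟩ : ∃ Z, c Z = X := by
    refine ⟨h * X * g, ?_⟩
    calc c (h * X * g) = (g * h) * X * (g * h) := by rw [hc]; noncomm_ring
      _ = X := by rw [hgh, one_mul, mul_one]
  rw [hF, hQ, hF, hq Z]

theorem contDiff_aeval (q : Polynomial ℝ) :
    ContDiff ℝ ∞ fun x : A => Polynomial.aeval x q := by
  simp only [Polynomial.aeval_eq_sum_range]
  refine ContDiff.sum fun i _ => ?_
  exact ContDiff.const_smul (q.coeff i) (contDiff_id.pow i)

theorem contDiff_aeval_commutator (q : Polynomial ℝ) :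
    ContDiff ℝ ∞ fun σ : A => Polynomial.aeval (commutator σ) q :=
  (contDiff_aeval (A := A →L[ℝ] A) q).comp (commutator (A := A)).contDiff

/-! ### A smooth ambient extension of the orbit form -/

/-- The form `(X, Y) ↦ φ(σ[Y, X])` attached to a linear functional `φ`. -/
def orbitForm (φ : A →ₗ[ℝ] ℝ) (σ X Y : A) : ℝ := φ (σ * (Y * X - X * Y))

theorem orbitForm_swap (φ : A →ₗ[ℝ] ℝ) (σ X Y : A) :
    orbitForm φ σ X Y = -orbitForm φ σ Y X := by
  rw [orbitForm, orbitForm, ← map_neg, ← mul_neg, neg_sub]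

theorem orbitForm_eq {φ : A →ₗ[ℝ] ℝ} (hφ : ∀ a b, φ (a * b) = φ (b * a)) (σ X Y : A) :
    orbitForm φ σ X Y = φ (Y * commutator σ X) := by
  rw [orbitForm, commutator_apply, mul_sub, mul_sub, map_sub, map_sub, hφ σ (Y * X), mul_assoc,
    ← mul_assoc σ X Y, hφ (σ * X) Y]

theorem orbitForm_congr {φ : A →ₗ[ℝ] ℝ} (hφ : ∀ a b, φ (a * b) = φ (b * a)) {σ X X' Y : A}
    (hX : commutator σ X = commutator σ X') : orbitForm φ σ X Y = orbitForm φ σ X' Y := by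
  rw [orbitForm_eq hφ, hX, orbitForm_eq hφ]

/-- The alternation of `(v, u) ↦ φ(q([·, σ])(v) u)`, normalized so that it extends the orbit form
wherever `q` is a pseudo-inverse. It depends polynomially on `σ`. -/
def ambientForm [FiniteDimensional ℝ A] (φ : A →ₗ[ℝ] ℝ) (q : Polynomial ℝ) (σ : A) : A [⋀^Fin 2]→L[ℝ] ℝ :=
  ContinuousAlternatingMap.alternatizeUncurryFinCLM ℝ A ℝ
    ((-(1 / 2 : ℝ)) • ((ContinuousAlternatingMap.ofSubsingletonLIE (𝕜 := ℝ) (E := A)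
      (F := ℝ) (0 : Fin 1)).toContinuousLinearEquiv.toContinuousLinearMap ∘L
        ((ContinuousLinearMap.compL ℝ A A ℝ φ.toContinuousLinearMap ∘L ContinuousLinearMap.mul ℝ A) ∘L
          Polynomial.aeval (commutator σ) q)))

theorem contDiff_ambientForm [FiniteDimensional ℝ A] (φ : A →ₗ[ℝ] ℝ) (q : Polynomial ℝ) :
    ContDiff ℝ ∞ (ambientForm φ q) := by
  have h : ContDiff ℝ ∞ fun σ : A =>
      (ContinuousLinearMap.compL ℝ A A ℝ φ.toContinuousLinearMap ∘L ContinuousLinearMap.mul ℝ A) ∘L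
        Polynomial.aeval (commutator σ) q :=
    contDiff_const.clm_comp (contDiff_aeval_commutator q)
  have h' := (contDiff_const (c := (ContinuousAlternatingMap.ofSubsingletonLIE (𝕜 := ℝ) (E := A)
    (F := ℝ) (0 : Fin 1)).toContinuousLinearEquiv.toContinuousLinearMap)).clm_comp h
  exact (ContinuousAlternatingMap.alternatizeUncurryFinCLM ℝ A ℝ).contDiff.comp
    (h'.const_smul (-(1 / 2 : ℝ)))

theorem ambientForm_apply [FiniteDimensional ℝ A] (φ : A →ₗ[ℝ] ℝ) (q : Polynomial ℝ) (σ u v : A) :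
    ambientForm φ q σ ![u, v] = (1 / 2) *
      (φ (Polynomial.aeval (commutator σ) q v * u) -
        φ (Polynomial.aeval (commutator σ) q u * v)) := by
  simp [ambientForm, ContinuousAlternatingMap.alternatizeUncurryFin_apply, Fin.sum_univ_two,
    ContinuousAlternatingMap.ofSubsingletonLIE, Fin.removeNth]
  ring

theorem ambientForm_commutator [FiniteDimensional ℝ A] {φ : A →ₗ[ℝ] ℝ} (hφ : ∀ a b, φ (a * b) = φ (b * a))
    {q : Polynomial ℝ} {σ : A} (hq : IsPseudoInverse q σ) (X Y : A) :
    ambientForm φ q σ ![commutator σ X, commutator σ Y] = orbitForm φ σ X Y := by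
  rw [ambientForm_apply, ← orbitForm_eq hφ, ← orbitForm_eq hφ, orbitForm_swap φ σ X,
    orbitForm_swap φ σ Y (Polynomial.aeval (commutator σ) q _), orbitForm_congr hφ (hq Y),
    orbitForm_congr hφ (hq X), orbitForm_swap φ σ Y X]
  ring

/-! ### Closedness along conjugacy classes -/

theorem lieBracket_commutator (X Y σ : A) :
    VectorField.lieBracket ℝ (fun τ => commutator τ X) (fun τ => commutator τ Y) σ =
      commutator σ (Y * X - X * Y) := by
  have hd (Z : A) : fderiv ℝ (fun τ : A => commutator τ Z) σ =
      commutator.flip Z := (commutator.flip Z).hasFDerivAt.fderiv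
  rw [VectorField.lieBracket, hd, hd]
  simp only [ContinuousLinearMap.flip_apply, commutator_apply]
  noncomm_ring

theorem differentiable_ambientForm_commutator [FiniteDimensional ℝ A] (φ : A →ₗ[ℝ] ℝ) (q : Polynomial ℝ) (X Y : A) :
    Differentiable ℝ fun τ => ambientForm φ q τ ![commutator τ X, commutator τ Y] := by
  have hF : ContDiff ℝ ∞ fun τ : A => commutator τ X := (commutator.flip X).contDiff
  have hG : ContDiff ℝ ∞ fun τ : A => commutator τ Y := (commutator.flip Y).contDiff
  have hQ := contDiff_aeval_commutator (A := A) q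
  have h1 := φ.toContinuousLinearMap.contDiff.comp ((hQ.clm_apply hG).mul hF)
  have h2 := φ.toContinuousLinearMap.contDiff.comp ((hQ.clm_apply hF).mul hG)
  have h := (contDiff_const (c := (1 / 2 : ℝ))).mul (h1.sub h2)
  simp only [ambientForm_apply]
  exact h.differentiable (by simp)

/-- The derivative of `ω(X̃, Ỹ)` in the direction `Z̃`: along the curve `exp(tZ) σ exp(-tZ)` the
ambient form restricts to `φ(σ[Y, X])`, which is linear in `σ`. -/
theorem fderiv_ambientForm_commutator [FiniteDimensional ℝ A] {φ : A →ₗ[ℝ] ℝ}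
    (hφ : ∀ a b, φ (a * b) = φ (b * a)) {q : Polynomial ℝ} {σ : A} (hq : IsPseudoInverse q σ)
    (X Y Z : A) :
    fderiv ℝ (fun τ => ambientForm φ q τ ![commutator τ X, commutator τ Y]) σ (commutator σ Z) =
      orbitForm φ (commutator σ Z) X Y := by
  have : CompleteSpace A := FiniteDimensional.complete ℝ A
  let _ : NormedAlgebra ℚ A := NormedAlgebra.restrictScalars ℚ ℝ A
  set c : ℝ → A :=
    fun t => NormedSpace.exp (t • Z) * σ * NormedSpace.exp (t • (-Z)) with hc
  have hc' : HasDerivAt c (commutator σ Z) 0 := by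
    have h1 := hasDerivAt_exp_smul_const (𝕂 := ℝ) Z (0 : ℝ)
    have h2 := hasDerivAt_exp_smul_const (𝕂 := ℝ) (-Z) (0 : ℝ)
    have h := (h1.mul_const σ).mul h2
    have e : NormedSpace.exp ((0 : ℝ) • Z) * Z * σ * NormedSpace.exp ((0 : ℝ) • (-Z)) +
        NormedSpace.exp ((0 : ℝ) • Z) * σ * (NormedSpace.exp ((0 : ℝ) • (-Z)) * -Z) =
        commutator σ Z := by
      simp [commutator_apply, sub_eq_add_neg]
    rw [← e]
    exact h
  have hc0 : c 0 = σ := by simp [hc]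
  have h1 := (((differentiable_ambientForm_commutator φ q X Y) (c 0)).hasFDerivAt).comp_hasDerivAt
    0 hc'
  set ψ : A →L[ℝ] ℝ :=
    φ.toContinuousLinearMap ∘L (ContinuousLinearMap.mul ℝ A).flip (Y * X - X * Y) with hψ
  have h2 := (ψ.hasFDerivAt (x := c 0)).comp_hasDerivAt 0 hc'
  have e : (fun τ => ambientForm φ q τ ![commutator τ X, commutator τ Y]) ∘ c = ψ ∘ c := by
    funext t
    have hu (a : A) : NormedSpace.exp a * NormedSpace.exp (-a) = 1 := by
      rw [← NormedSpace.exp_add_of_commute (Commute.refl a).neg_right, add_neg_cancel,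
        NormedSpace.exp_zero]
    refine ambientForm_commutator hφ (hq.conj ?_ ?_) X Y
    · rw [smul_neg, hu]
    · simpa using hu (-(t • Z))
  rw [e] at h1
  have := h1.unique h2
  rwa [hc0] at this

/-- The Jacobi identity makes the cyclic sum of the forms `φ(σ[·, [·, ·]])` vanish. -/
theorem orbitForm_jacobi (φ : A →ₗ[ℝ] ℝ) (σ X Y Z : A) :
    orbitForm φ σ (Y * X - X * Y) Z + orbitForm φ σ (Z * Y - Y * Z) X +
      orbitForm φ σ (X * Z - Z * X) Y = 0 := by
  simp only [orbitForm, ← map_add]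
  convert map_zero φ using 2
  noncomm_ring

theorem orbitForm_commutator {φ : A →ₗ[ℝ] ℝ} (hφ : ∀ a b, φ (a * b) = φ (b * a)) (σ X Y Z : A) :
    orbitForm φ (commutator σ Z) X Y = orbitForm φ σ (X * Y - Y * X) Z := by
  rw [orbitForm, hφ, ← orbitForm_eq hφ, orbitForm_swap]
  simp only [orbitForm, ← map_neg]
  congr 1
  noncomm_ring

/-- The invariant formula for the exterior derivative of a `2`-form. -/
theorem extDeriv_two_form_apply {E : Type*} [NormedAddCommGroup E] [NormedSpace ℝ E]
    {Ω : E → E [⋀^Fin 2]→L[ℝ] ℝ} {x : E} (hΩ : DifferentiableAt ℝ Ω x) {U V W : E → E}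
    (hU : DifferentiableAt ℝ U x) (hV : DifferentiableAt ℝ V x) (hW : DifferentiableAt ℝ W x) :
    extDeriv Ω x ![U x, V x, W x] =
      fderiv ℝ (fun y => Ω y ![V y, W y]) x (U x) - fderiv ℝ (fun y => Ω y ![U y, W y]) x (V x) +
        fderiv ℝ (fun y => Ω y ![U y, V y]) x (W x) -
      (Ω x ![VectorField.lieBracket ℝ U V x, W x] - Ω x ![VectorField.lieBracket ℝ U W x, V x] +
        Ω x ![VectorField.lieBracket ℝ V W x, U x]) := by
  have e (y : E) : (fun i => ![U, V, W] i y) = ![U y, V y, W y] := by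
    funext i; fin_cases i <;> rfl
  have r0 (u v w : E) : (0 : Fin 3).removeNth ![u, v, w] = ![v, w] := by
    funext i; fin_cases i <;> rfl
  have r1 (u v w : E) : (1 : Fin 3).removeNth ![u, v, w] = ![u, w] := by
    funext i; fin_cases i <;> rfl
  have r2 (u v w : E) : (2 : Fin 3).removeNth ![u, v, w] = ![u, v] := by
    funext i; fin_cases i <;> rfl
  have s0 (u v : E) : (0 : Fin 2).removeNth ![u, v] = ![v] := by
    funext i; fin_cases i; rfl
  have s1 (u v : E) : (1 : Fin 2).removeNth ![u, v] = ![u] := by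
    funext i; fin_cases i; rfl
  have i0 : Finset.Ici (0 : Fin 2) = {0, 1} := by decide
  have i1 : Finset.Ici (1 : Fin 2) = {1} := by decide
  have key : extDeriv Ω x (fun i : Fin 3 => ![U, V, W] i x) =
      (∑ i : Fin 3, (-1) ^ i.val • fderiv ℝ
        (fun y => Ω y (i.removeNth fun k : Fin 3 => ![U, V, W] k y)) x (![U, V, W] i x)) -
      ∑ i : Fin 2, ∑ j ∈ Finset.Ici i, (-1) ^ (i + j : ℕ) •
        Ω x (Matrix.vecCons (VectorField.lieBracket ℝ (![U, V, W] i.castSucc)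
          (![U, V, W] j.succ) x)
            (j.removeNth (i.castSucc.removeNth fun k : Fin 3 => ![U, V, W] k x))) :=
    extDeriv_apply_vectorField (V := ![U, V, W]) hΩ fun i => by fin_cases i <;> assumption
  have c0 : Fin.castSucc (0 : Fin 2) = 0 := rfl
  have c1 : Fin.castSucc (1 : Fin 2) = 1 := rfl
  have d0 : Fin.succ (0 : Fin 2) = 1 := rfl
  have d1 : Fin.succ (1 : Fin 2) = 2 := rfl
  have v0 : ![U, V, W] 0 = U := rfl
  have v1 : ![U, V, W] 1 = V := rfl
  have v2 : ![U, V, W] 2 = W := rfl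
  have h01 : (0 : Fin 2) ∉ ({1} : Finset (Fin 2)) := by decide
  simp only [e, Fin.sum_univ_three, Fin.sum_univ_two, i0, i1, c0, c1, d0, d1, v0, v1, v2, r0, r1,
    r2, s0, s1, Finset.sum_insert h01, Finset.sum_singleton] at key
  rw [key]
  norm_num
  ring

/-- The orbit form is closed: in the invariant formula for the exterior derivative on the vector
fields `[X, ·]`, `[Y, ·]`, `[Z, ·]`, the derivative terms and the bracket terms both cancel by the
Jacobi identity. -/
theorem extDeriv_ambientForm_commutator [FiniteDimensional ℝ A] {φ : A →ₗ[ℝ] ℝ}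
    (hφ : ∀ a b, φ (a * b) = φ (b * a)) {q : Polynomial ℝ} {σ : A} (hq : IsPseudoInverse q σ)
    (X Y Z : A) :
    extDeriv (ambientForm φ q) σ ![commutator σ X, commutator σ Y, commutator σ Z] = 0 := by
  have hω : DifferentiableAt ℝ (ambientForm φ q) σ :=
    ((contDiff_ambientForm φ q).differentiable (by simp)) σ
  have hd (T : A) : DifferentiableAt ℝ (fun τ : A => commutator τ T) σ :=
    (commutator.flip T).differentiableAt
  rw [extDeriv_two_form_apply (U := fun τ => commutator τ X) (V := fun τ => commutator τ Y)
    (W := fun τ => commutator τ Z) hω (hd X) (hd Y) (hd Z)]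
  simp only [lieBracket_commutator, fderiv_ambientForm_commutator hφ hq,
    ambientForm_commutator hφ hq, orbitForm_commutator hφ]
  have j := orbitForm_jacobi φ σ X Y Z
  have e (a b c : A) : orbitForm φ σ (a * b - b * a) c = -orbitForm φ σ (b * a - a * b) c := by
    simp only [orbitForm, ← map_neg]
    congr 1
    noncomm_ring
  rw [e X Y, e X Z, e Y Z, e Z X]
  linarith [e X Z Y]

end NormedAlgebra

section Matrices

variable {n m : Type*} [Fintype n] [DecidableEq n] [Fintype m] [DecidableEq m]

/-! ### Commutators with real diagonal matrices -/

/-- The diagonal matrix with real entries `d`. -/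
def realDiagonal (d : n → ℝ) : Matrix n n ℂ := Matrix.diagonal fun i => (d i : ℂ)

theorem fundamental_apply (σ X : Matrix n n ℂ) : fundamental σ X = X * σ - σ * X := rfl

theorem fundamental_realDiagonal (d : n → ℝ) (X : Matrix n n ℂ) (a b : n) :
    fundamental (realDiagonal d) X a b = ((d b - d a : ℝ) : ℂ) * X a b := by
  simp only [fundamental_apply, realDiagonal, Matrix.sub_apply, Matrix.mul_diagonal,
    Matrix.diagonal_mul]
  push_cast
  ring

theorem aeval_commutator_realDiagonal (d : n → ℝ) (q : Polynomial ℝ) (X : Matrix n n ℂ)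
    (a b : n) :
    Polynomial.aeval (commutator (realDiagonal d)) q X a b =
      ((q.eval (d b - d a) : ℝ) : ℂ) * X a b := by
  induction q using Polynomial.induction_on' with
  | add p q hp hq =>
    have e : Polynomial.aeval (commutator (realDiagonal d)) (p + q) X =
        Polynomial.aeval (commutator (realDiagonal d)) p X +
          Polynomial.aeval (commutator (realDiagonal d)) q X := by
      rw [map_add]; rfl
    rw [e, Matrix.add_apply, hp, hq, Polynomial.eval_add]
    push_cast
    ring
  | monomial k r =>
    have hk : ((commutator (realDiagonal d) ^ k) X : Matrix n n ℂ) a b =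
        ((d b - d a : ℝ) : ℂ) ^ k * X a b := by
      induction k with
      | zero => rw [pow_zero, pow_zero, one_mul]; rfl
      | succ k ih =>
        have e : (commutator (realDiagonal d) ^ (k + 1)) X =
            fundamental (realDiagonal d) ((commutator (realDiagonal d) ^ k) X) := by
          rw [pow_succ']; rfl
        rw [e, fundamental_realDiagonal, ih]
        ring
    have e : Polynomial.aeval (commutator (realDiagonal d)) (Polynomial.monomial k r) X =
        r • (commutator (realDiagonal d) ^ k) X := by
      rw [Polynomial.aeval_monomial, Algebra.algebraMap_eq_smul_one, smul_mul_assoc, one_mul]; rfl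
    rw [e, Matrix.smul_apply, hk, Polynomial.eval_monomial, Complex.real_smul]
    push_cast
    ring

/-- Interpolating `t ↦ t⁻¹` at the differences of the eigenvalues gives a pseudo-inverse. -/
theorem exists_isPseudoInverse_realDiagonal (d : n → ℝ) :
    ∃ q, IsPseudoInverse q (realDiagonal d) := by
  refine ⟨Lagrange.interpolate (Finset.univ.image fun x : n × n => d x.2 - d x.1) id
    fun t => t⁻¹, fun X => ?_⟩
  have hF (Y : Matrix n n ℂ) : commutator (realDiagonal d) Y = fundamental (realDiagonal d) Y := rfl
  ext a b
  have hnode := Lagrange.eval_interpolate_at_node (fun t : ℝ => t⁻¹)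
    (s := Finset.univ.image fun x : n × n => d x.2 - d x.1) (v := id) (Set.injOn_id _)
    (Finset.mem_image_of_mem _ (Finset.mem_univ (a, b)))
  simp only [id] at hnode
  rw [hF, hF, fundamental_realDiagonal, aeval_commutator_realDiagonal, fundamental_realDiagonal,
    hnode]
  -- A zero difference is covered as well, since `0⁻¹ = 0`.
  rw [← mul_assoc, ← mul_assoc, ← Complex.ofReal_mul, ← Complex.ofReal_mul, mul_inv_mul_cancel]

/-! ### The Kirillov-Kostant-Souriau form is smooth and closed on local orbits -/

/-- The tracial functional `M ↦ (i | M)`, whose orbit form is the Kirillov-Kostant-Souriau form. -/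
def traceFunctional : Matrix n n ℂ →ₗ[ℝ] ℝ where
  toFun M := traceInner (Complex.I • (1 : Matrix n n ℂ)) M
  map_add' M M' := by simp [traceInner, add_comm]
  map_smul' c M := by simp [traceInner]

theorem traceFunctional_apply (M : Matrix n n ℂ) :
    traceFunctional M = traceInner (Complex.I • (1 : Matrix n n ℂ)) M := rfl

theorem traceFunctional_mul_comm (M M' : Matrix n n ℂ) :
    traceFunctional (M * M') = traceFunctional (M' * M) := by
  simp only [traceFunctional_apply, traceInner, Matrix.smul_mul, one_mul, Matrix.trace_smul,
    Matrix.trace_mul_comm M M']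

theorem orbitForm_traceFunctional (σ X Y : Matrix n n ℂ) :
    orbitForm traceFunctional σ X Y = kksOnAlgebra σ X Y := by
  simp only [orbitForm, traceFunctional_apply, kksOnAlgebra, traceInner, Matrix.smul_mul, one_mul]

theorem kksLocal_apply (σ : Matrix (n × m) (n × m) ℂ) (u v : orbitTangent (suLocal n m) σ)
    {X Y : Matrix (n × m) (n × m) ℂ} (hX : fundamental σ X = u) (hY : fundamental σ Y = v) :
    kksLocal σ u v = kksOnAlgebra σ X Y := by
  refine kksOnAlgebra_congr ?_ ?_
  · rw [hX]; exact fundamental_lift _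
  · rw [hY]; exact fundamental_lift _

/-- Smoothness and closedness hold on every family of conjugates of a fixed real diagonal matrix, so
only non-degeneracy is at stake. -/
theorem isSymplecticForm_kksLocal_of_nondegenerate (d : n × m → ℝ)
    {M : Set (Matrix (n × m) (n × m) ℂ)}
    (hM : ∀ σ ∈ M, ∃ g h, g * h = 1 ∧ σ = g * realDiagonal d * h)
    (hnd : ∀ σ ∈ M, (kksLocal σ).Nondegenerate) :
    IsSymplecticForm M (orbitTangent (suLocal n m)) kksLocal := by
  obtain ⟨q, hq⟩ := exists_isPseudoInverse_realDiagonal d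
  refine ⟨fun σ _ => ⟨Set.univ, isOpen_univ, Set.mem_univ _, ambientForm traceFunctional q,
    (contDiff_ambientForm _ q).contDiffOn, fun τ hτ => ?_⟩, hnd⟩
  have hqτ : IsPseudoInverse q τ := by
    obtain ⟨g, h, hgh, rfl⟩ := hM τ hτ.2
    exact hq.conj hgh (mul_eq_one_comm.1 hgh)
  constructor
  · rintro ⟨_, X, hX, rfl⟩ ⟨_, Y, hY, rfl⟩
    rw [kksLocal_apply τ _ _ rfl rfl, ← orbitForm_traceFunctional]
    exact (ambientForm_commutator traceFunctional_mul_comm hqτ X Y).symm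
  · rintro ⟨_, X, hX, rfl⟩ ⟨_, Y, hY, rfl⟩ ⟨_, Z, hZ, rfl⟩
    exact extDeriv_ambientForm_commutator traceFunctional_mul_comm hqτ X Y Z

/-! ### Non-degeneracy in terms of the Lie algebra -/

theorem kksLocal_nondegenerate_iff (σ : Matrix (n × m) (n × m) ℂ) :
    (kksLocal σ).Nondegenerate ↔ ∀ X ∈ suLocal n m,
      (∀ Y ∈ suLocal n m, kksOnAlgebra σ X Y = 0) → fundamental σ X = 0 := by
  constructor
  · intro h X hX hXY
    have := h.1 ⟨fundamental σ X, X, hX, rfl⟩ ?_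
    · exact congrArg Subtype.val this
    · rintro ⟨_, Y, hY, rfl⟩
      rw [kksLocal_apply σ _ _ rfl rfl, hXY Y hY]
  · intro h
    refine ⟨?_, ?_⟩
    · rintro ⟨_, X, hX, rfl⟩ hu
      refine Subtype.ext (h X hX fun Y hY => ?_)
      rw [← hu ⟨fundamental σ Y, Y, hY, rfl⟩, kksLocal_apply σ _ _ rfl rfl]
    · rintro ⟨_, X, hX, rfl⟩ hu
      refine Subtype.ext (h X hX fun Y hY => ?_)
      rw [kksOnAlgebra_swap, ← neg_zero, ← hu ⟨fundamental σ Y, Y, hY, rfl⟩,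
        kksLocal_apply σ _ _ rfl rfl]

theorem conj_mul_conj {g : Matrix n n ℂ} (hg : gᴴ * g = 1) (a b : Matrix n n ℂ) :
    g * a * gᴴ * (g * b * gᴴ) = g * (a * b) * gᴴ := by
  calc g * a * gᴴ * (g * b * gᴴ) = g * a * (gᴴ * g) * b * gᴴ := by noncomm_ring
    _ = _ := by rw [hg]; noncomm_ring

theorem kksOnAlgebra_conj {g : Matrix n n ℂ} (hg : gᴴ * g = 1) (σ X Y : Matrix n n ℂ) :
    kksOnAlgebra (g * σ * gᴴ) (g * X * gᴴ) (g * Y * gᴴ) = kksOnAlgebra σ X Y := by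
  have e : Complex.I • (g * σ * gᴴ) * (g * Y * gᴴ * (g * X * gᴴ) - g * X * gᴴ * (g * Y * gᴴ)) =
      g * (Complex.I • σ * (Y * X - X * Y)) * gᴴ := by
    rw [conj_mul_conj hg, conj_mul_conj hg, ← sub_mul, ← mul_sub, Matrix.smul_mul,
      conj_mul_conj hg, Matrix.smul_mul, Matrix.mul_smul, Matrix.smul_mul]
  rw [kksOnAlgebra, traceInner, e, Matrix.trace_mul_cycle, hg, one_mul]
  rfl

theorem conj_mem_su {g : Matrix n n ℂ} (hg : gᴴ * g = 1) {X : Matrix n n ℂ} (hX : X ∈ su n) :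
    g * X * gᴴ ∈ su n := by
  refine ⟨?_, ?_⟩
  · rw [Matrix.conjTranspose_mul, Matrix.conjTranspose_mul, Matrix.conjTranspose_conjTranspose,
      hX.1]
    noncomm_ring
  · rw [Matrix.trace_mul_cycle, hg, one_mul, hX.2]

theorem conj_kronecker_mem_suLocal {U : Matrix n n ℂ} {V : Matrix m m ℂ} (hU : Uᴴ * U = 1)
    (hV : Vᴴ * V = 1) {X : Matrix (n × m) (n × m) ℂ} (hX : X ∈ suLocal n m) :
    (U ⊗ₖ V) * X * (U ⊗ₖ V)ᴴ ∈ suLocal n m := by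
  obtain ⟨X₁, h₁, X₂, h₂, rfl⟩ := hX
  refine ⟨U * X₁ * Uᴴ, conj_mem_su hU h₁, V * X₂ * Vᴴ, conj_mem_su hV h₂, ?_⟩
  rw [Matrix.conjTranspose_kronecker, mul_add, add_mul, ← Matrix.mul_kronecker_mul,
    ← Matrix.mul_kronecker_mul, ← Matrix.mul_kronecker_mul, ← Matrix.mul_kronecker_mul, mul_one,
    mul_one, mul_eq_one_comm.1 hU, mul_eq_one_comm.1 hV]

theorem kronecker_conjTranspose_mul_self {U : Matrix n n ℂ} {V : Matrix m m ℂ} (hU : Uᴴ * U = 1)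
    (hV : Vᴴ * V = 1) : (U ⊗ₖ V)ᴴ * (U ⊗ₖ V) = 1 := by
  rw [Matrix.conjTranspose_kronecker, ← Matrix.mul_kronecker_mul, hU, hV, Matrix.one_kronecker_one]

theorem kksLocal_nondegenerate_of_conj {U : Matrix n n ℂ} {V : Matrix m m ℂ} (hU : Uᴴ * U = 1)
    (hV : Vᴴ * V = 1) {σ : Matrix (n × m) (n × m) ℂ}
    (h : (kksLocal ((U ⊗ₖ V) * σ * (U ⊗ₖ V)ᴴ)).Nondegenerate) : (kksLocal σ).Nondegenerate := by
  rw [kksLocal_nondegenerate_iff] at h ⊢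
  have hg := kronecker_conjTranspose_mul_self hU hV
  have hg' := mul_eq_one_comm.1 hg
  set g := U ⊗ₖ V
  have hinv (Y : Matrix (n × m) (n × m) ℂ) : g * (gᴴ * Y * g) * gᴴ = Y := by
    calc g * (gᴴ * Y * g) * gᴴ = (g * gᴴ) * Y * (g * gᴴ) := by noncomm_ring
      _ = Y := by rw [hg', one_mul, mul_one]
  have hinv' (Y : Matrix (n × m) (n × m) ℂ) : gᴴ * (g * Y * gᴴ) * g = Y := by
    calc gᴴ * (g * Y * gᴴ) * g = (gᴴ * g) * Y * (gᴴ * g) := by noncomm_ring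
      _ = Y := by rw [hg, one_mul, mul_one]
  intro X hX hXY
  have := h (g * X * gᴴ) (conj_kronecker_mem_suLocal hU hV hX) fun Y hY => ?_
  · rw [fundamental_apply, conj_mul_conj hg, conj_mul_conj hg, ← sub_mul, ← mul_sub] at this
    rw [← hinv' (fundamental σ X), fundamental_apply, this, mul_zero, zero_mul]
  · rw [← hinv Y, kksOnAlgebra_conj hg]
    refine hXY _ ?_
    have hY' := conj_kronecker_mem_suLocal (U := Uᴴ) (V := Vᴴ)
      (by rw [Matrix.conjTranspose_conjTranspose]; exact mul_eq_one_comm.1 hU)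
      (by rw [Matrix.conjTranspose_conjTranspose]; exact mul_eq_one_comm.1 hV) hY
    rwa [← Matrix.conjTranspose_kronecker, Matrix.conjTranspose_conjTranspose] at hY'

theorem kksLocal_conj_nondegenerate_iff {U : Matrix n n ℂ} {V : Matrix m m ℂ} (hU : Uᴴ * U = 1)
    (hV : Vᴴ * V = 1) (σ : Matrix (n × m) (n × m) ℂ) :
    (kksLocal ((U ⊗ₖ V) * σ * (U ⊗ₖ V)ᴴ)).Nondegenerate ↔ (kksLocal σ).Nondegenerate := by
  refine ⟨kksLocal_nondegenerate_of_conj hU hV, fun h => ?_⟩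
  refine kksLocal_nondegenerate_of_conj (U := Uᴴ) (V := Vᴴ)
    (by rw [Matrix.conjTranspose_conjTranspose]; exact mul_eq_one_comm.1 hU)
    (by rw [Matrix.conjTranspose_conjTranspose]; exact mul_eq_one_comm.1 hV) ?_
  have hg := kronecker_conjTranspose_mul_self hU hV
  rw [← Matrix.conjTranspose_kronecker, Matrix.conjTranspose_conjTranspose]
  suffices e : (U ⊗ₖ V)ᴴ * ((U ⊗ₖ V) * σ * (U ⊗ₖ V)ᴴ) * (U ⊗ₖ V) = σ by rwa [e]
  calc (U ⊗ₖ V)ᴴ * ((U ⊗ₖ V) * σ * (U ⊗ₖ V)ᴴ) * (U ⊗ₖ V) =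
      ((U ⊗ₖ V)ᴴ * (U ⊗ₖ V)) * σ * ((U ⊗ₖ V)ᴴ * (U ⊗ₖ V)) := by noncomm_ring
    _ = σ := by rw [hg, one_mul, mul_one]

/-! ### Non-degeneracy at a diagonal state -/

open scoped ComplexOrder in
/-- On a single factor the radical of `(X, Y) ↦ (iσ | [Y, X])` is the centralizer of `σ`: for
`Y = i[X, σ]` the form is `(Y | Y)`. -/
theorem fundamental_eq_zero_of_kksOnAlgebra_eq_zero {σ X : Matrix n n ℂ} (hσ : σᴴ = σ)
    (hX : X ∈ su n) (h : ∀ Y ∈ su n, kksOnAlgebra σ X Y = 0) : fundamental σ X = 0 := by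
  have hF : (fundamental σ X)ᴴ = fundamental σ X := by
    rw [fundamental_apply, Matrix.conjTranspose_sub, Matrix.conjTranspose_mul,
      Matrix.conjTranspose_mul, hσ, hX.1]
    noncomm_ring
  set Y := Complex.I • fundamental σ X with hY
  have hYH : Yᴴ = -Y := by
    rw [hY, Matrix.conjTranspose_smul, hF]
    simp
  have hYsu : Y ∈ su n := by
    refine ⟨hYH, ?_⟩
    rw [hY, Matrix.trace_smul, fundamental_apply, Matrix.trace_sub, Matrix.trace_mul_comm, sub_self,
      smul_zero]
  have h0 := h Y hYsu
  rw [kksOnAlgebra_eq_left, ← hY] at h0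
  have h1 := traceInner_eq hYH hYH
  rw [h0, ← Matrix.trace_neg, ← Matrix.neg_mul, ← hYH] at h1
  have h2 : Y = 0 := Matrix.trace_conjTranspose_mul_self_eq_zero_iff.1 h1.symm
  exact (smul_eq_zero.1 h2).resolve_left Complex.I_ne_zero

theorem realDiagonal_conjTranspose {ι : Type*} [DecidableEq ι] (d : ι → ℝ) : (realDiagonal d)ᴴ = realDiagonal d := by
  rw [realDiagonal, Matrix.diagonal_conjTranspose]
  congr 1
  funext i
  simp

/-- The marginals of a diagonal state enter through its pairing with `su(n) ⊕ su(m)`. -/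
theorem kksOnAlgebra_realDiagonal_local (p : n → m → ℝ) (X₁ Y₁ : Matrix n n ℂ)
    (X₂ Y₂ : Matrix m m ℂ) :
    kksOnAlgebra (realDiagonal fun x : n × m => p x.1 x.2)
        (X₁ ⊗ₖ (1 : Matrix m m ℂ) + (1 : Matrix n n ℂ) ⊗ₖ X₂)
        (Y₁ ⊗ₖ (1 : Matrix m m ℂ) + (1 : Matrix n n ℂ) ⊗ₖ Y₂) =
      kksOnAlgebra (realDiagonal fun i => ∑ l, p i l) X₁ Y₁ +
        kksOnAlgebra (realDiagonal fun l => ∑ i, p i l) X₂ Y₂ := by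
  have hc : (Y₁ ⊗ₖ (1 : Matrix m m ℂ) + (1 : Matrix n n ℂ) ⊗ₖ Y₂) *
        (X₁ ⊗ₖ (1 : Matrix m m ℂ) + (1 : Matrix n n ℂ) ⊗ₖ X₂) -
      (X₁ ⊗ₖ (1 : Matrix m m ℂ) + (1 : Matrix n n ℂ) ⊗ₖ X₂) *
        (Y₁ ⊗ₖ (1 : Matrix m m ℂ) + (1 : Matrix n n ℂ) ⊗ₖ Y₂) =
      (Y₁ * X₁ - X₁ * Y₁) ⊗ₖ (1 : Matrix m m ℂ) +
        (1 : Matrix n n ℂ) ⊗ₖ (Y₂ * X₂ - X₂ * Y₂) := by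
    simp only [add_mul, mul_add, ← Matrix.mul_kronecker_mul, one_mul, mul_one,
      sub_eq_add_neg (Y₁ * X₁), sub_eq_add_neg (Y₂ * X₂), Matrix.add_kronecker,
      Matrix.kronecker_add, ← neg_one_smul ℂ (X₁ * Y₁), ← neg_one_smul ℂ (X₂ * Y₂),
      Matrix.smul_kronecker, Matrix.kronecker_smul]
    module
  have h1 (B : Matrix n n ℂ) : (realDiagonal (fun x : n × m => p x.1 x.2) *
      (B ⊗ₖ (1 : Matrix m m ℂ))).trace = (realDiagonal (fun i => ∑ l, p i l) * B).trace := by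
    simp [realDiagonal, Matrix.trace, Matrix.diagonal_mul, Fintype.sum_prod_type, Finset.sum_mul]
  have h2 (B : Matrix m m ℂ) : (realDiagonal (fun x : n × m => p x.1 x.2) *
      ((1 : Matrix n n ℂ) ⊗ₖ B)).trace = (realDiagonal (fun l => ∑ i, p i l) * B).trace := by
    simp only [realDiagonal, Matrix.trace, Matrix.diagonal_mul, Matrix.diag_apply,
      Fintype.sum_prod_type_right, Matrix.kroneckerMap_apply, Matrix.one_apply_eq, one_mul,
      Complex.ofReal_sum, Finset.sum_mul]
  simp only [kksOnAlgebra, traceInner]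
  rw [hc]
  simp only [Matrix.smul_mul, mul_add, Matrix.trace_smul, Matrix.trace_add, h1, h2,
    Complex.add_re, neg_add]

/-- The rotation generator `E_ij - E_ji`. -/
theorem single_sub_single_mem_su {i j : n} (hij : i ≠ j) :
    Matrix.single i j (1 : ℂ) - Matrix.single j i 1 ∈ su n := by
  refine ⟨?_, ?_⟩
  · simp
  · simp [hij, hij.symm]

/-- Equal marginals `d i = d j` put `E_ij - E_ji` into the centralizer. -/
theorem fundamental_realDiagonal_single {d : n → ℝ} {i j : n} (h : d i = d j) :
    fundamental (realDiagonal d) (Matrix.single i j (1 : ℂ) - Matrix.single j i 1) = 0 := by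
  ext a b
  rw [fundamental_realDiagonal, Matrix.zero_apply, Matrix.sub_apply, Matrix.single_apply,
    Matrix.single_apply]
  by_cases h1 : i = a ∧ j = b
  · rw [← h1.1, ← h1.2, h, sub_self, Complex.ofReal_zero, zero_mul]
  · by_cases h2 : j = a ∧ i = b
    · rw [← h2.1, ← h2.2, h, sub_self, Complex.ofReal_zero, zero_mul]
    · rw [if_neg h1, if_neg h2, sub_self, mul_zero]

theorem kksOnAlgebra_eq_zero_of_fundamental_eq_zero {σ X : Matrix n n ℂ}
    (h : fundamental σ X = 0) (Y : Matrix n n ℂ) : kksOnAlgebra σ X Y = 0 := by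
  rw [kksOnAlgebra_eq_left, h, smul_zero, traceInner, mul_zero, Matrix.trace_zero]
  simp

/-- At a diagonal state the radical condition on `X₁ ⊗ 1 + 1 ⊗ X₂` says that `X₁` and `X₂` commute
with the marginals, while a vanishing tangent vector means that they commute with the whole state.
The two agree exactly when equal entries of a marginal come from equal rows (or columns) of `p`. -/
theorem kksLocal_realDiagonal_nondegenerate_iff (p : n → m → ℝ) :
    (kksLocal (realDiagonal fun x : n × m => p x.1 x.2)).Nondegenerate ↔
      (∀ i j : n, i ≠ j → ∑ l, p i l = ∑ l, p j l → ∀ l, p i l = p j l) ∧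
      (∀ i j : m, i ≠ j → ∑ l, p l i = ∑ l, p l j → ∀ l, p l i = p l j) := by
  rw [kksLocal_nondegenerate_iff]
  constructor
  · intro h
    constructor
    · intro i j hij hr l
      have key := h ((Matrix.single i j (1 : ℂ) - Matrix.single j i 1) ⊗ₖ (1 : Matrix m m ℂ) +
        (1 : Matrix n n ℂ) ⊗ₖ (0 : Matrix m m ℂ))
        ⟨_, single_sub_single_mem_su hij, 0, zero_mem _, rfl⟩ ?_
      · have e := congrFun (congrFun key (i, l)) (j, l)
        rw [fundamental_realDiagonal] at e
        simp [hij] at e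
        exact_mod_cast (sub_eq_zero.1 e).symm
      · rintro _ ⟨Y₁, -, Y₂, -, rfl⟩
        rw [kksOnAlgebra_realDiagonal_local, kksOnAlgebra_eq_zero_of_fundamental_eq_zero
          (fundamental_realDiagonal_single (d := fun i => ∑ l, p i l) hr),
          kksOnAlgebra_eq_zero_of_fundamental_eq_zero (map_zero _), add_zero]
    · intro i j hij hr l
      have key := h ((0 : Matrix n n ℂ) ⊗ₖ (1 : Matrix m m ℂ) +
        (1 : Matrix n n ℂ) ⊗ₖ (Matrix.single i j (1 : ℂ) - Matrix.single j i 1))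
        ⟨0, zero_mem _, _, single_sub_single_mem_su hij, rfl⟩ ?_
      · have e := congrFun (congrFun key (l, i)) (l, j)
        rw [fundamental_realDiagonal] at e
        simp [hij] at e
        exact_mod_cast (sub_eq_zero.1 e).symm
      · rintro _ ⟨Y₁, -, Y₂, -, rfl⟩
        rw [kksOnAlgebra_realDiagonal_local, kksOnAlgebra_eq_zero_of_fundamental_eq_zero (X := 0)
          (map_zero _), kksOnAlgebra_eq_zero_of_fundamental_eq_zero
          (fundamental_realDiagonal_single (d := fun l => ∑ i, p i l) hr), add_zero]
  · rintro ⟨hrow, hcol⟩ _ ⟨X₁, h₁, X₂, h₂, rfl⟩ hXY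
    have e₁ := fundamental_eq_zero_of_kksOnAlgebra_eq_zero
      (realDiagonal_conjTranspose fun i : n => ∑ l, p i l) h₁ fun Y₁ hY₁ => by
        have := hXY _ ⟨Y₁, hY₁, 0, zero_mem _, rfl⟩
        rwa [kksOnAlgebra_realDiagonal_local, kksOnAlgebra_swap _ X₂,
          kksOnAlgebra_eq_zero_of_fundamental_eq_zero (map_zero _), neg_zero, add_zero] at this
    have e₂ := fundamental_eq_zero_of_kksOnAlgebra_eq_zero
      (realDiagonal_conjTranspose fun l : m => ∑ i, p i l) h₂ fun Y₂ hY₂ => by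
        have := hXY _ ⟨0, zero_mem _, Y₂, hY₂, rfl⟩
        rwa [kksOnAlgebra_realDiagonal_local, kksOnAlgebra_swap _ X₁,
          kksOnAlgebra_eq_zero_of_fundamental_eq_zero (map_zero _), neg_zero, zero_add] at this
    ext ⟨a, k⟩ ⟨b, l⟩
    have e₁' := congrFun (congrFun e₁ a) b
    have e₂' := congrFun (congrFun e₂ k) l
    rw [fundamental_realDiagonal, Matrix.zero_apply, mul_eq_zero, Complex.ofReal_eq_zero,
      sub_eq_zero] at e₁' e₂'
    rw [fundamental_realDiagonal, Matrix.zero_apply, Matrix.add_apply, mul_add,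
      Matrix.kroneckerMap_apply, Matrix.kroneckerMap_apply]
    have t₁ : ((p b l - p a k : ℝ) : ℂ) * (X₁ a b * (1 : Matrix m m ℂ) k l) = 0 := by
      by_cases hkl : k = l
      · subst hkl
        by_cases hab : a = b
        · rw [hab, sub_self, Complex.ofReal_zero, zero_mul]
        · rcases e₁' with e | e
          · rw [hrow a b hab e.symm k, sub_self, Complex.ofReal_zero, zero_mul]
          · rw [e, zero_mul, mul_zero]
      · rw [Matrix.one_apply_ne hkl, mul_zero, mul_zero]
    have t₂ : ((p b l - p a k : ℝ) : ℂ) * ((1 : Matrix n n ℂ) a b * X₂ k l) = 0 := by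
      by_cases hab : a = b
      · subst hab
        by_cases hkl : k = l
        · rw [hkl, sub_self, Complex.ofReal_zero, zero_mul]
        · rcases e₂' with e | e
          · rw [hcol k l hkl e.symm a, sub_self, Complex.ofReal_zero, zero_mul]
          · rw [e, mul_zero, mul_zero]
      · rw [Matrix.one_apply_ne hab, zero_mul, mul_zero]
    rw [t₁, t₂, add_zero]

/-! ### Classical-classical states -/

/-- The matrix whose columns are the vectors of the orthonormal basis `e`. -/
def basisMatrix (e : OrthonormalBasis n ℂ (EuclideanSpace ℂ n)) : Matrix n n ℂ :=
  Matrix.of fun a i => e i a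

theorem basisMatrix_conjTranspose_mul_self (e : OrthonormalBasis n ℂ (EuclideanSpace ℂ n)) :
    (basisMatrix e)ᴴ * basisMatrix e = 1 := by
  ext i j
  have h := orthonormal_iff_ite.1 e.orthonormal i j
  rw [PiLp.inner_apply] at h
  rw [Matrix.mul_apply, Matrix.one_apply, ← h]
  refine Finset.sum_congr rfl fun a _ => ?_
  simp [basisMatrix, mul_comm]

theorem ccOperator_eq (e : OrthonormalBasis n ℂ (EuclideanSpace ℂ n))
    (f : OrthonormalBasis m ℂ (EuclideanSpace ℂ m)) (p : n → m → ℝ) :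
    ccOperator e f p = (basisMatrix e ⊗ₖ basisMatrix f) *
      realDiagonal (fun x : n × m => p x.1 x.2) * (basisMatrix e ⊗ₖ basisMatrix f)ᴴ := by
  ext ⟨a, k⟩ ⟨b, l⟩
  rw [Matrix.mul_apply]
  simp only [realDiagonal, Matrix.mul_diagonal, Fintype.sum_prod_type, ccOperator,
    Matrix.sum_apply, Matrix.smul_apply, Matrix.kroneckerMap_apply, Matrix.conjTranspose_apply,
    basisMatrix, ketBra, Matrix.of_apply, smul_eq_mul, star_mul']
  refine Finset.sum_congr rfl fun i _ => Finset.sum_congr rfl fun j _ => ?_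
  ring

theorem localOrbitIsSymplectic_ccOperator_iff (e : OrthonormalBasis n ℂ (EuclideanSpace ℂ n))
    (f : OrthonormalBasis m ℂ (EuclideanSpace ℂ m)) (p : n → m → ℝ) :
    LocalOrbitIsSymplectic (ccOperator e f p) ↔
      (∀ i j : n, i ≠ j → ∑ l, p i l = ∑ l, p j l → ∀ l, p i l = p j l) ∧
      (∀ i j : m, i ≠ j → ∑ l, p l i = ∑ l, p l j → ∀ l, p l i = p l j) := by
  have he := basisMatrix_conjTranspose_mul_self e
  have hf := basisMatrix_conjTranspose_mul_self f
  have hρ : (kksLocal (ccOperator e f p)).Nondegenerate ↔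
      (kksLocal (realDiagonal fun x : n × m => p x.1 x.2)).Nondegenerate := by
    rw [ccOperator_eq]
    exact kksLocal_conj_nondegenerate_iff he hf _
  rw [← kksLocal_realDiagonal_nondegenerate_iff, ← hρ]
  constructor
  · intro h
    exact h.nondegenerate _ ⟨1, one_mem _, 1, one_mem _, by simp⟩
  · intro h
    refine isSymplecticForm_kksLocal_of_nondegenerate (fun x => p x.1 x.2) ?_ ?_
    · rintro _ ⟨U, hU, V, hV, rfl⟩
      have hU' : Uᴴ * U = 1 := (Matrix.mem_specialUnitaryGroup_iff.1 hU).1.1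
      have hV' : Vᴴ * V = 1 := (Matrix.mem_specialUnitaryGroup_iff.1 hV).1.1
      have h1 := mul_eq_one_comm.1 (kronecker_conjTranspose_mul_self hU' hV')
      have h2 := mul_eq_one_comm.1 (kronecker_conjTranspose_mul_self he hf)
      refine ⟨(U ⊗ₖ V) * (basisMatrix e ⊗ₖ basisMatrix f),
        (basisMatrix e ⊗ₖ basisMatrix f)ᴴ * (U ⊗ₖ V)ᴴ, ?_, ?_⟩
      · rw [mul_assoc, ← mul_assoc _ _ (U ⊗ₖ V)ᴴ, h2, one_mul, h1]
      · rw [ccOperator_eq]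
        noncomm_ring
    · rintro _ ⟨U, hU, V, hV, rfl⟩
      exact (kksLocal_conj_nondegenerate_iff (Matrix.mem_specialUnitaryGroup_iff.1 hU).1.1
        (Matrix.mem_specialUnitaryGroup_iff.1 hV).1.1 _).2 h

end Matrices

end LocalOrbits

end

theorem mainTheorem6 (N₁ N₂ : ℕ)
    (e : OrthonormalBasis (Fin N₁) ℂ (EuclideanSpace ℂ (Fin N₁)))
    (f : OrthonormalBasis (Fin N₂) ℂ (EuclideanSpace ℂ (Fin N₂)))
    (p : Fin N₁ → Fin N₂ → ℝ) (hp : ∀ i j, 0 ≤ p i j) (hsum : ∑ i, ∑ j, p i j = 1) :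
    LocalOrbits.LocalOrbitIsSymplectic (LocalOrbits.ccOperator e f p) ↔
      (∀ i j : Fin N₁, i ≠ j → ∑ l, p i l = ∑ l, p j l → ∀ l, p i l = p j l) ∧
      (∀ i j : Fin N₂, i ≠ j → ∑ l, p l i = ∑ l, p l j → ∀ l, p l i = p l j) := by
  exact LocalOrbits.localOrbitIsSymplectic_ccOperator_iff e f p
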